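/- For a finite simple graph $G$ let $D(G)$ be the diagonal matrix of vertex degrees, $A(G)$ the adjacency matrix, $Q(G)=D(G)+A(G)$ the signless Laplacian matrix, and $q(G)$ the largest eigenvalue of $Q(G)$. Let $\theta(1,2,3)$ be the graph consisting of two vertices connected by three internally disjoint paths of lengths $1$, $2$ and $3$; a graph is $\theta(1,2,3)$-free if it has no (not necessarily induced) subgraph isomorphic to $\theta(1,2,3)$. Let $S_{n,2}=K_2\vee (n-2)K_1$ be the graph obtained by joining each vertex of $K_2$ to $n-2$ isolated vertices. **Theorem 1.3.** Let $G$ be a $\theta(1,2,3)$-free graph on $n\ge 6$ vertices. Then $$q(G)\le q(S_{n,2}),$$ with equality if and only if $G\cong S_{n,2}$. -/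

import Mathlib

/-- The signless Laplacian matrix `Q(G) = D(G) + A(G)` of a finite simple graph. -/
def signlessLaplacian {V : Type*} [Fintype V] [DecidableEq V] (G : SimpleGraph V)
    [DecidableRel G.Adj] : Matrix V V ℝ :=
  G.degMatrix ℝ + G.adjMatrix ℝ

/-- The signless Laplacian spectral radius `q(G)`: the largest eigenvalue of `Q(G)`
(the supremum is a maximum, see `isGreatest_signlessRadius`). -/
noncomputable def signlessRadius {V : Type*} [Fintype V] [DecidableEq V] (G : SimpleGraph V)
    [DecidableRel G.Adj] : ℝ :=
  sSup {μ : ℝ | Module.End.HasEigenvalue (Matrix.toLin' (signlessLaplacian G)) μ}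

/-- `q(G)` really is the largest eigenvalue of `Q(G)` as soon as `G` has a vertex. -/
theorem isGreatest_signlessRadius {V : Type*} [Fintype V] [DecidableEq V] [Nonempty V]
    (G : SimpleGraph V) [DecidableRel G.Adj] :
    IsGreatest {μ : ℝ | Module.End.HasEigenvalue (Matrix.toLin' (signlessLaplacian G)) μ}
      (signlessRadius G) := by
  have hfin : {μ : ℝ | Module.End.HasEigenvalue
      (Matrix.toLin' (signlessLaplacian G)) μ}.Finite :=
    Module.End.finite_hasEigenvalue _
  have hQ : (signlessLaplacian G).IsHermitian :=
    (G.isHermitian_degMatrix ℝ).add (G.isHermitian_adjMatrix (R := ℝ))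
  have hne : {μ : ℝ | Module.End.HasEigenvalue
      (Matrix.toLin' (signlessLaplacian G)) μ}.Nonempty := by
    obtain ⟨i⟩ := ‹Nonempty V›
    refine ⟨hQ.eigenvalues i, ?_⟩
    have h := hQ.eigenvalues_mem_spectrum_real i
    rw [← Matrix.spectrum_toLin'] at h
    exact Module.End.hasEigenvalue_iff_mem_spectrum.mpr h
  exact ⟨hne.csSup_mem hfin, fun μ hμ => le_csSup hfin.bddAbove hμ⟩

/-- The lengths of the three paths of a theta graph, as a function on `Fin 3`. -/
abbrev thetaLen (l₁ l₂ l₃ : ℕ) : Fin 3 → ℕ := ![l₁, l₂, l₃]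

/-- Vertices of `θ(l₁, l₂, l₃)`: the two end vertices, and `lᵢ - 1` internal vertices on the
`i`-th path. -/
abbrev ThetaVertex (l₁ l₂ l₃ : ℕ) : Type :=
  Bool ⊕ (Σ i : Fin 3, Fin (thetaLen l₁ l₂ l₃ i - 1))

/-- The `j`-th vertex (`0 ≤ j ≤ lᵢ`) of the `i`-th path, which runs from the end vertex `false`
(at `j = 0`) to the end vertex `true` (at `j = lᵢ`). -/
def thetaPath (l₁ l₂ l₃ : ℕ) (i : Fin 3) (j : ℕ) : ThetaVertex l₁ l₂ l₃ :=
  if j = 0 then Sum.inl false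
  else if h : j - 1 < thetaLen l₁ l₂ l₃ i - 1 then Sum.inr ⟨i, ⟨j - 1, h⟩⟩
  else Sum.inl true

/-- The theta graph `θ(l₁, l₂, l₃)`: two vertices connected by three internally disjoint paths
of lengths `l₁`, `l₂` and `l₃` (all positive, at most one of them equal to `1`). -/
def thetaGraph (l₁ l₂ l₃ : ℕ) : SimpleGraph (ThetaVertex l₁ l₂ l₃) :=
  SimpleGraph.fromRel fun x y => ∃ (i : Fin 3) (j : ℕ), j < thetaLen l₁ l₂ l₃ i ∧
    x = thetaPath l₁ l₂ l₃ i j ∧ y = thetaPath l₁ l₂ l₃ i (j + 1)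

/-- The join `G ∨ H` of two graphs on disjoint vertex sets: the disjoint union together with all
edges between `G` and `H`. -/
def graphJoin {V W : Type*} (G : SimpleGraph V) (H : SimpleGraph W) : SimpleGraph (V ⊕ W) where
  Adj
    | Sum.inl u, Sum.inl v => G.Adj u v
    | Sum.inr u, Sum.inr v => H.Adj u v
    | Sum.inl _, Sum.inr _ => True
    | Sum.inr _, Sum.inl _ => True
  symm := ⟨by
    rintro (u | u) (v | v) h
    · exact SimpleGraph.Adj.symm (G := G) h
    · trivial
    · trivial
    · exact SimpleGraph.Adj.symm (G := H) h⟩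
  loopless := ⟨by
    rintro (u | u) h
    · exact G.irrefl h
    · exact H.irrefl h⟩

instance graphJoinDecidable {V W : Type*} (G : SimpleGraph V) (H : SimpleGraph W)
    [DecidableRel G.Adj] [DecidableRel H.Adj] : DecidableRel (graphJoin G H).Adj
  | Sum.inl u, Sum.inl v => inferInstanceAs (Decidable (G.Adj u v))
  | Sum.inr u, Sum.inr v => inferInstanceAs (Decidable (H.Adj u v))
  | Sum.inl _, Sum.inr _ => isTrue trivial
  | Sum.inr _, Sum.inl _ => isTrue trivial

/-- The graph `S_{n,k} = K_k ∨ (n - k) K_1` on `n` vertices (for `k ≤ n`). -/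
abbrev splitGraph (n k : ℕ) : SimpleGraph (Fin k ⊕ Fin (n - k)) :=
  graphJoin (⊤ : SimpleGraph (Fin k)) (⊥ : SimpleGraph (Fin (n - k)))

/-!
Why `S_{n,2}` is extremal. Let `r` be the larger root of `r² - (n + 2) r + 4`; it is an eigenvalue
of `Q(S_{n,2})`, with eigenvector `r - 2` on `K₂` and `2` elsewhere. By the Collatz–Wielandt bound
(`signlessRadius_lt_of_pos`) it is enough to find, for every `θ(1,2,3)`-free graph `G` other than
`S_{n,2}`, a positive vector `y` with `Q(G) y < r y` in every coordinate.

The graph `θ(1,2,3)` is a triangle and a quadrilateral sharing an edge. Hence the link of a vertex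
`u`, the graph induced on `N(u)`, contains no path on four vertices, so its components are
triangles, stars and isolated vertices, and a vertex outside the closed neighbourhood with several
neighbours in `N(u)` is joined either to isolated vertices of the link only or to the two ends of
one component `K₂` (`codegree_cases`).

If no vertex is universal, the degree vector serves as `y`: counting the walks of length two from
`u` by their end vertex bounds `∑_{v ∼ u} d(v)` (`sum_degree_neighborFinset_le`) well enough.

If `u` is universal, the degree vector fails, for instance when many components of `G - u` are
triangles. The vector of `signlessRadius_lt_of_universal` is used instead. Its coordinate at `u`
makes the row of `u` an equality for `S_{n,2}`, and that row is strict for other graphs because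
the weights of the components of `G - u` add up to less than the weight of one spanning star
(`PathFourFree.sum_starWeight_lt`). If `G - u` does have a spanning star, it has no further edge
and `G` is `S_{n,2}`.
-/

/-! ### Eigenvalues of the signless Laplacian -/

theorem hasEigenvalue_signlessLaplacian_iff {V : Type*} [Fintype V] [DecidableEq V]
    (G : SimpleGraph V) [DecidableRel G.Adj] (μ : ℝ) :
    Module.End.HasEigenvalue (Matrix.toLin' (signlessLaplacian G)) μ ↔
      ∃ x : V → ℝ, x ≠ 0 ∧
        ∀ v, (G.degree v : ℝ) * x v + ∑ w ∈ G.neighborFinset v, x w = μ * x v := by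
  have key : ∀ x : V → ℝ, Matrix.toLin' (signlessLaplacian G) x = μ • x ↔
      ∀ v, (G.degree v : ℝ) * x v + ∑ w ∈ G.neighborFinset v, x w = μ * x v := by
    intro x
    rw [funext_iff]
    refine forall_congr' fun v => ?_
    simp [signlessLaplacian, SimpleGraph.degMatrix,
      Matrix.mulVec_diagonal, SimpleGraph.adjMatrix_mulVec_apply]
  constructor
  · intro h
    obtain ⟨x, hx⟩ := h.exists_hasEigenvector
    exact ⟨x, hx.2, (key x).1 hx.apply_eq_smul⟩
  · rintro ⟨x, hx, h⟩
    exact Module.End.hasEigenvalue_of_hasEigenvector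
      ⟨Module.End.mem_eigenspace_iff.2 ((key x).2 h), hx⟩

/-- The Collatz–Wielandt bound: a positive vector `y` with `Q y < c y` entrywise forces
`q(G) < c`. -/
theorem signlessRadius_lt_of_pos {V : Type*} [Fintype V] [DecidableEq V] [Nonempty V]
    (G : SimpleGraph V) [DecidableRel G.Adj] {c : ℝ} (y : V → ℝ) (hy : ∀ v, 0 < y v)
    (h : ∀ v, (G.degree v : ℝ) * y v + ∑ w ∈ G.neighborFinset v, y w < c * y v) :
    signlessRadius G < c := by
  obtain ⟨x, hx, hx'⟩ :=
    (hasEigenvalue_signlessLaplacian_iff G _).1 (isGreatest_signlessRadius G).1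
  set μ := signlessRadius G
  -- the vertex at which `|x| / y` is largest
  obtain ⟨v, -, hv⟩ := Finset.exists_max_image Finset.univ (fun v => |x v| / y v)
    Finset.univ_nonempty
  have hle : ∀ w, |x w| ≤ |x v| / y v * y w := fun w =>
    (div_le_iff₀ (hy w)).1 (hv w (Finset.mem_univ w))
  have hpos : 0 < |x v| / y v := by
    obtain ⟨w, hw⟩ := Function.ne_iff.1 hx
    exact (div_pos (abs_pos.2 hw) (hy w)).trans_le (hv w (Finset.mem_univ w))
  set t := |x v| / y v with ht
  have hxv : |x v| = t * y v := by rw [ht, div_mul_cancel₀ _ (hy v).ne']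
  have h1 : μ * |x v| ≤ (G.degree v : ℝ) * |x v| + ∑ w ∈ G.neighborFinset v, |x w| := by
    calc μ * |x v| ≤ |μ| * |x v| := mul_le_mul_of_nonneg_right (le_abs_self μ) (abs_nonneg _)
      _ = |(G.degree v : ℝ) * x v + ∑ w ∈ G.neighborFinset v, x w| := by rw [hx' v, abs_mul]
      _ ≤ |(G.degree v : ℝ) * x v| + |∑ w ∈ G.neighborFinset v, x w| := abs_add_le _ _
      _ ≤ _ := by
        rw [abs_mul, Nat.abs_cast]
        exact add_le_add_right (Finset.abs_sum_le_sum_abs _ _) _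
  have h2 : ∑ w ∈ G.neighborFinset v, |x w| ≤ t * ∑ w ∈ G.neighborFinset v, y w := by
    rw [Finset.mul_sum]
    exact Finset.sum_le_sum fun w _ => hle w
  have h3 := mul_lt_mul_of_pos_left (h v) hpos
  rw [hxv] at h1
  have h4 : (t * y v) * μ < (t * y v) * c := by linarith
  exact lt_of_mul_lt_mul_left h4 (mul_pos hpos (hy v)).le

theorem hasEigenvalue_signlessLaplacian_of_iso {V W : Type*} [Fintype V] [DecidableEq V]
    [Fintype W] [DecidableEq W] {G : SimpleGraph V} [DecidableRel G.Adj] {H : SimpleGraph W}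
    [DecidableRel H.Adj] (e : G ≃g H) {μ : ℝ}
    (hμ : Module.End.HasEigenvalue (Matrix.toLin' (signlessLaplacian H)) μ) :
    Module.End.HasEigenvalue (Matrix.toLin' (signlessLaplacian G)) μ := by
  rw [hasEigenvalue_signlessLaplacian_iff] at hμ ⊢
  obtain ⟨x, hx, h⟩ := hμ
  refine ⟨x ∘ e, ?_, fun v => ?_⟩
  · obtain ⟨w, hw⟩ := Function.ne_iff.1 hx
    exact Function.ne_iff.2 ⟨e.symm w, by simpa using hw⟩
  · have h1 := h (e v)
    have h2 : ∑ w ∈ H.neighborFinset (e v), x w = ∑ w ∈ G.neighborFinset v, x (e w) := by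
      symm
      refine Finset.sum_bij (fun w _ => e w) ?_ ?_ ?_ ?_
      · intro w hw
        rw [SimpleGraph.mem_neighborFinset] at hw ⊢
        exact e.map_adj_iff.2 hw
      · intro a _ b _ hab
        exact e.injective hab
      · intro w hw
        refine ⟨e.symm w, ?_, by simp⟩
        rw [SimpleGraph.mem_neighborFinset] at hw ⊢
        rw [← e.map_adj_iff]
        simpa using hw
      · intro _ _
        rfl
    rw [h2, e.degree_eq] at h1
    exact h1

theorem signlessRadius_congr {V W : Type*} [Fintype V] [DecidableEq V] [Fintype W]
    [DecidableEq W] {G : SimpleGraph V} [DecidableRel G.Adj] {H : SimpleGraph W}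
    [DecidableRel H.Adj] (e : G ≃g H) : signlessRadius G = signlessRadius H := by
  unfold signlessRadius
  congr 1
  ext μ
  exact ⟨hasEigenvalue_signlessLaplacian_of_iso e.symm,
    hasEigenvalue_signlessLaplacian_of_iso e⟩

/-! ### The extremal graph -/

/-- The larger root of `r² - (n + 2) r + 4`, which stands in for `q(S_{n,2})` in all estimates. -/
theorem exists_root_gt {n : ℕ} (hn : 6 ≤ n) :
    ∃ r : ℝ, r * r = (n + 2) * r - 4 ∧ (n : ℝ) + 7 / 5 < r := by
  have hn' : (6 : ℝ) ≤ n := by exact_mod_cast hn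
  have h0 : (0 : ℝ) ≤ ((n : ℝ) + 2) ^ 2 - 16 := by nlinarith
  have h1 : (n : ℝ) + 4 / 5 < √(((n : ℝ) + 2) ^ 2 - 16) :=
    Real.lt_sqrt_of_sq_lt (by nlinarith)
  have h2 := Real.mul_self_sqrt h0
  refine ⟨((n : ℝ) + 2 + √(((n : ℝ) + 2) ^ 2 - 16)) / 2, by nlinarith, by linarith⟩

theorem le_signlessRadius_splitGraph {n : ℕ} (hn : 6 ≤ n) {r : ℝ}
    (hr : r * r = (n + 2) * r - 4) (hr' : (n : ℝ) + 7 / 5 < r) :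
    r ≤ signlessRadius (splitGraph n 2) := by
  refine (isGreatest_signlessRadius (splitGraph n 2)).2 ?_
  rw [Set.mem_ofPred_eq, hasEigenvalue_signlessLaplacian_iff]
  refine ⟨Sum.elim (fun _ => r - 2) (fun _ => 2), ?_, ?_⟩
  · refine Function.ne_iff.2 ⟨Sum.inl 0, ?_⟩
    have hn' : (6 : ℝ) ≤ n := by exact_mod_cast hn
    simp only [Sum.elim_inl, Pi.zero_apply]
    linarith
  · have hc : ((n - 2 : ℕ) : ℝ) = n - 2 := by
      rw [Nat.cast_sub (by omega)]
      norm_num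
    have hl : ∀ i : Fin 2, (splitGraph n 2).neighborFinset (Sum.inl i) =
        Finset.univ.erase (Sum.inl i) := by
      intro i
      ext (w | w) <;> simp [graphJoin, eq_comm]
    have hr : ∀ i : Fin (n - 2), (splitGraph n 2).neighborFinset (Sum.inr i) =
        Finset.univ.image Sum.inl := by
      intro i
      ext (w | w) <;> simp [graphJoin]
    rintro (i | i)
    · rw [← SimpleGraph.card_neighborFinset_eq_degree, hl,
        Finset.sum_erase_eq_sub (Finset.mem_univ _), Finset.card_erase_of_mem (Finset.mem_univ _)]
      have : ((Finset.univ : Finset (Fin 2 ⊕ Fin (n - 2))).card - 1 : ℕ) = n - 1 := by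
        simp
        omega
      rw [this, Nat.cast_sub (by omega)]
      simp [hc]
      linarith
    · rw [← SimpleGraph.card_neighborFinset_eq_degree, hr,
        Finset.card_image_of_injective _ Sum.inl_injective,
        Finset.sum_image (fun _ _ _ _ h => Sum.inl_injective h)]
      simp
      ring

/-- Two universal vertices and no edge avoiding both of them determine `S_{n,2}`. -/
theorem nonempty_iso_splitGraph {V : Type*} [Fintype V] [DecidableEq V] {n : ℕ}
    (hV : Fintype.card V = n) (G : SimpleGraph V) {u c : V} (huc : u ≠ c)
    (h : ∀ x y, G.Adj x y ↔ x ≠ y ∧ ((x = u ∨ x = c) ∨ (y = u ∨ y = c))) :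
    Nonempty (G ≃g splitGraph n 2) := by
  have hcard : Fintype.card {x : V // x = u ∨ x = c} = 2 := by
    rw [Fintype.card_subtype, ← Finset.card_pair huc]
    congr 1
    ext x
    simp
  have hcard' : Fintype.card {x : V // ¬ (x = u ∨ x = c)} = n - 2 := by
    rw [Fintype.card_subtype_compl, hcard, hV]
  let e₁ := Fintype.equivFinOfCardEq hcard
  let e₂ := Fintype.equivFinOfCardEq hcard'
  let e : (Fin 2 ⊕ Fin (n - 2)) ≃ V :=
    (Equiv.sumCongr e₁.symm e₂.symm).trans (Equiv.sumCompl fun x => x = u ∨ x = c)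
  refine ⟨(RelIso.mk e ?_).symm⟩
  have el : ∀ a, e (Sum.inl a) = (e₁.symm a : V) := fun _ => rfl
  have er : ∀ a, e (Sum.inr a) = (e₂.symm a : V) := fun _ => rfl
  intro x y
  rw [h, e.injective.ne_iff]
  rcases x with a | a <;> rcases y with b | b
  · have := (e₁.symm a).2
    rw [el, el]
    simp [graphJoin, this]
  · have := (e₁.symm a).2
    rw [el, er]
    simp [graphJoin, this]
  · have := (e₁.symm b).2
    rw [el, er]
    simp [graphJoin, this]
  · have h1 := (e₂.symm a).2
    have h2 := (e₂.symm b).2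
    rw [er, er]
    simp only [h1, h2, or_self, and_false, false_iff]
    exact fun h => h

/-! ### The forbidden subgraph -/

/-- `θ(1,2,3)` is the triangle `s t a` and the quadrilateral `s t c b` glued along `s t`. -/
theorem false_of_thetaGraph_free {V : Type*} {G : SimpleGraph V} (hG : (thetaGraph 1 2 3).Free G)
    {s t a b c : V} (hst : G.Adj s t) (hsa : G.Adj s a) (hat : G.Adj a t) (hsb : G.Adj s b)
    (hbc : G.Adj b c) (hct : G.Adj c t) (hsc : s ≠ c) (htb : t ≠ b) (hab : a ≠ b)
    (hac : a ≠ c) : False := by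
  let f : ThetaVertex 1 2 3 → V
    | Sum.inl false => s
    | Sum.inl true => t
    | Sum.inr ⟨⟨0, _⟩, _⟩ => s
    | Sum.inr ⟨⟨1, _⟩, _⟩ => a
    | Sum.inr ⟨⟨_ + 2, _⟩, ⟨0, _⟩⟩ => b
    | Sum.inr ⟨⟨_ + 2, _⟩, ⟨_ + 1, _⟩⟩ => c
  have hrel : ∀ (i : Fin 3) (j : ℕ), j < thetaLen 1 2 3 i →
      G.Adj (f (thetaPath 1 2 3 i j)) (f (thetaPath 1 2 3 i (j + 1))) := by
    intro i j hj
    fin_cases i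
    · have : j < 1 := hj
      interval_cases j
      exact hst
    · have : j < 2 := hj
      interval_cases j
      · exact hsa
      · exact hat
    · have : j < 3 := hj
      interval_cases j
      · exact hsb
      · exact hbc
      · exact hct
  refine hG ⟨⟨⟨f, ?_⟩, ?_⟩⟩
  · rintro x y ⟨-, ⟨i, j, hj, rfl, rfl⟩ | ⟨i, j, hj, rfl, rfl⟩⟩
    · exact hrel i j hj
    · exact (hrel i j hj).symm
  · have e1 := hst.ne
    have e2 := hsa.ne
    have e3 := hat.ne
    have e4 := hsb.ne
    have e5 := hbc.ne
    have e6 := hct.ne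
    have hall : ∀ x : ThetaVertex 1 2 3, x = Sum.inl false ∨ x = Sum.inl true ∨
        x = Sum.inr ⟨1, ⟨0, by decide⟩⟩ ∨ x = Sum.inr ⟨2, ⟨0, by decide⟩⟩ ∨
        x = Sum.inr ⟨2, ⟨1, by decide⟩⟩ := by
      decide
    have f1 : f (Sum.inl false) = s := rfl
    have f2 : f (Sum.inl true) = t := rfl
    have f3 : f (Sum.inr ⟨1, ⟨0, by decide⟩⟩) = a := rfl
    have f4 : f (Sum.inr ⟨2, ⟨0, by decide⟩⟩) = b := rfl
    have f5 : f (Sum.inr ⟨2, ⟨1, by decide⟩⟩) = c := rfl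
    intro x y hxy
    change f x = f y at hxy
    rcases hall x with rfl | rfl | rfl | rfl | rfl <;>
      rcases hall y with rfl | rfl | rfl | rfl | rfl <;>
      simp only [f1, f2, f3, f4, f5] at hxy <;> first | rfl | (exfalso; grind)

/-- In a `θ(1,2,3)`-free graph, if `x` and `y` are common neighbours of `u` and `w`, then `x` has no
neighbour in `N(u)` other than `y` and `w`. -/
theorem eq_of_thetaGraph_free {V : Type*} {G : SimpleGraph V} (hG : (thetaGraph 1 2 3).Free G)
    {u x y w a : V} (hx : G.Adj u x) (hy : G.Adj u y) (ha : G.Adj u a) (hwu : w ≠ u)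
    (hwx : G.Adj w x) (hwy : G.Adj w y) (hxy : x ≠ y) (hxa : G.Adj x a) (haw : a ≠ w) :
    a = y := by
  by_contra hay
  exact false_of_thetaGraph_free hG hx ha hxa.symm hy hwy.symm hwx hwu.symm hxy hay haw

/-! ### Graphs without a path on four vertices -/

/-- `H` has no path on four vertices as a (not necessarily induced) subgraph. -/
def PathFourFree {V : Type*} (H : SimpleGraph V) : Prop :=
  ∀ ⦃a b c d : V⦄, H.Adj a b → H.Adj b c → H.Adj c d → a ≠ c → b ≠ d → a = d

/-- `v` lies on a triangle of `H`. -/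
def InTriangle {V : Type*} (H : SimpleGraph V) (v : V) : Prop :=
  ∃ a b, H.Adj v a ∧ H.Adj v b ∧ H.Adj a b

open Classical in
/-- The centres of the star components with at least two leaves, for a graph all of whose components
are triangles and stars. -/
noncomputable def starCentres {V : Type*} [Fintype V] (H : SimpleGraph V) [DecidableRel H.Adj] :
    Finset V :=
  Finset.univ.filter fun v => 2 ≤ H.degree v ∧ ¬ InTriangle H v

open Classical in
/-- The vertices of `H` that lie on triangles. -/
noncomputable def triangleVertices {V : Type*} [Fintype V] (H : SimpleGraph V) : Finset V :=
  Finset.univ.filter fun v => InTriangle H v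

/-- The vertices of degree one. -/
def leaves {V : Type*} [Fintype V] (H : SimpleGraph V) [DecidableRel H.Adj] : Finset V :=
  Finset.univ.filter fun v => H.degree v = 1

section PathFourFree

variable {V : Type*} [Fintype V] {H : SimpleGraph V}

theorem mem_triangleVertices {v : V} : v ∈ triangleVertices H ↔ InTriangle H v := by
  simp [triangleVertices]

variable [DecidableRel H.Adj]

theorem mem_starCentres {v : V} : v ∈ starCentres H ↔ 2 ≤ H.degree v ∧ ¬ InTriangle H v := by
  simp [starCentres]

theorem mem_leaves {v : V} : v ∈ leaves H ↔ H.degree v = 1 := by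
  simp [leaves]

theorem degree_eq_one_of_forall {x c : V} (hx : H.Adj x c) (h : ∀ y, H.Adj x y → y = c) :
    H.degree x = 1 := by
  rw [← SimpleGraph.card_neighborFinset_eq_degree, Finset.card_eq_one]
  refine ⟨c, Finset.ext fun y => ?_⟩
  rw [SimpleGraph.mem_neighborFinset, Finset.mem_singleton]
  exact ⟨h y, fun h => h ▸ hx⟩

theorem disjoint_starCentres_triangleVertices : Disjoint (starCentres H) (triangleVertices H) :=
  Finset.disjoint_left.2 fun _ h h' => (mem_starCentres.1 h).2 (mem_triangleVertices.1 h')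

variable [DecidableEq V]

theorem PathFourFree.degree_eq_two (hH : PathFourFree H) {v : V} (hv : InTriangle H v) :
    H.degree v = 2 := by
  obtain ⟨a, b, ha, hb, hab⟩ := hv
  rw [← SimpleGraph.card_neighborFinset_eq_degree, ← Finset.card_pair hab.ne]
  congr 1
  ext x
  simp only [SimpleGraph.mem_neighborFinset, Finset.mem_insert, Finset.mem_singleton]
  refine ⟨fun hx => ?_, ?_⟩
  · by_contra! hne
    exact hne.2 (hH hx.symm ha hab hne.1 hb.ne)
  · rintro (rfl | rfl) <;> assumption

/-- The neighbours of a star centre are leaves. -/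
theorem PathFourFree.eq_of_adj_starCentre (hH : PathFourFree H) {c x y : V}
    (hc : c ∈ starCentres H) (hx : H.Adj c x) (hy : H.Adj x y) : y = c := by
  obtain ⟨h2, hT⟩ := mem_starCentres.1 hc
  by_contra hne
  obtain ⟨b, hb, hbx⟩ := Finset.exists_mem_ne (s := H.neighborFinset c) (by
    rw [SimpleGraph.card_neighborFinset_eq_degree]
    omega) x
  rw [SimpleGraph.mem_neighborFinset] at hb
  have := hH hy.symm hx.symm hb hne hbx.symm
  subst this
  exact hT ⟨x, y, hx, hb, hy⟩

theorem PathFourFree.degree_eq_one (hH : PathFourFree H) {c x : V}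
    (hc : c ∈ starCentres H) (hx : H.Adj c x) : H.degree x = 1 :=
  degree_eq_one_of_forall hx.symm fun _ hy => hH.eq_of_adj_starCentre hc hx hy

theorem PathFourFree.disjoint_leaves (hH : PathFourFree H) :
    Disjoint (starCentres H ∪ triangleVertices H) (leaves H) := by
  refine Finset.disjoint_left.2 fun v h h' => ?_
  rw [mem_leaves] at h'
  rcases Finset.mem_union.1 h with h | h
  · have := (mem_starCentres.1 h).1
    omega
  · have := hH.degree_eq_two (mem_triangleVertices.1 h)
    omega

/-- The stars are disjoint, so the degrees of their centres count distinct leaves. -/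
theorem PathFourFree.sum_degree_starCentres_le (hH : PathFourFree H) :
    ∑ c ∈ starCentres H, H.degree c ≤
      ((leaves H).filter fun l => ∃ c ∈ starCentres H, H.Adj c l).card := by
  have h : ∑ c ∈ starCentres H, H.degree c =
      ((starCentres H).biUnion fun c => H.neighborFinset c).card := by
    rw [Finset.card_biUnion]
    · simp
    · intro c hc d hd hcd
      refine Finset.disjoint_left.2 fun x hx hx' => hcd ?_
      rw [SimpleGraph.mem_neighborFinset] at hx hx'
      exact hH.eq_of_adj_starCentre hd hx' hx.symm
  rw [h]
  refine Finset.card_le_card fun x hx => ?_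
  simp only [Finset.mem_biUnion, SimpleGraph.mem_neighborFinset] at hx
  obtain ⟨c, hc, hx⟩ := hx
  exact Finset.mem_filter.2 ⟨mem_leaves.2 (hH.degree_eq_one hc hx), c, hc, hx⟩

theorem PathFourFree.sum_degree_starCentres_le_card_leaves (hH : PathFourFree H) :
    ∑ c ∈ starCentres H, H.degree c ≤ (leaves H).card :=
  hH.sum_degree_starCentres_le.trans (Finset.card_filter_le _ _)

/-- The leaves of a component `K₂` are not counted by the degrees of the star centres. -/
theorem PathFourFree.sum_degree_starCentres_add_two_le (hH : PathFourFree H) {x a : V}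
    (hxa : H.Adj x a) (hx : H.degree x = 1) (ha : H.degree a = 1) :
    (∑ c ∈ starCentres H, H.degree c) + 2 ≤ (leaves H).card := by
  have h1 : ∀ {p q : V}, H.Adj p q → H.degree p = 1 → H.degree q = 1 →
      ¬ ∃ c ∈ starCentres H, H.Adj c p := by
    rintro p q hpq hp hq ⟨c, hc, hcp⟩
    have := hH.eq_of_adj_starCentre hc hcp hpq
    subst this
    have := (mem_starCentres.1 hc).1
    omega
  have h2 : ((leaves H).filter fun l => ∃ c ∈ starCentres H, H.Adj c l) ⊆
      (leaves H) \ {x, a} := by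
    intro l hl
    rw [Finset.mem_filter] at hl
    refine Finset.mem_sdiff.2 ⟨hl.1, fun h => ?_⟩
    simp only [Finset.mem_insert, Finset.mem_singleton] at h
    rcases h with rfl | rfl
    · exact h1 hxa hx ha hl.2
    · exact h1 hxa.symm ha hx hl.2
  have h3 : ({x, a} : Finset V) ⊆ leaves H := by
    intro l hl
    simp only [Finset.mem_insert, Finset.mem_singleton] at hl
    rcases hl with rfl | rfl <;> exact mem_leaves.2 ‹_›
  have h4 := Finset.card_le_card h2
  have h5 := Finset.card_le_card h3
  rw [Finset.card_sdiff_of_subset h3] at h4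
  rw [Finset.card_pair hxa.ne] at h4 h5
  have := hH.sum_degree_starCentres_le
  omega

theorem mem_of_degree_pos {v : V} (h : 0 < H.degree v) :
    v ∈ (starCentres H ∪ triangleVertices H) ∪ leaves H := by
  simp only [Finset.mem_union, mem_starCentres, mem_triangleVertices, mem_leaves]
  by_cases hT : InTriangle H v
  · exact Or.inl (Or.inr hT)
  · rcases Nat.lt_or_ge (H.degree v) 2 with h2 | h2
    · exact Or.inr (by omega)
    · exact Or.inl (Or.inl ⟨h2, hT⟩)

theorem PathFourFree.card_union (hH : PathFourFree H) :
    ((starCentres H ∪ triangleVertices H) ∪ leaves H).card =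
      (starCentres H).card + (triangleVertices H).card + (leaves H).card := by
  rw [Finset.card_union_of_disjoint hH.disjoint_leaves,
    Finset.card_union_of_disjoint disjoint_starCentres_triangleVertices]

theorem PathFourFree.sum_degree (hH : PathFourFree H) :
    ∑ v, H.degree v = ∑ c ∈ starCentres H, H.degree c + 2 * (triangleVertices H).card +
      (leaves H).card := by
  have h1 : ∑ v, H.degree v =
      ∑ v ∈ (starCentres H ∪ triangleVertices H) ∪ leaves H, H.degree v := by
    symm
    refine Finset.sum_subset (Finset.subset_univ _) fun v _ hv => ?_
    by_contra h
    exact hv (mem_of_degree_pos (Nat.pos_of_ne_zero h))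
  rw [h1, Finset.sum_union hH.disjoint_leaves,
    Finset.sum_union disjoint_starCentres_triangleVertices]
  have h2 : ∑ v ∈ triangleVertices H, H.degree v = (triangleVertices H).card * 2 :=
    Finset.sum_const_nat fun v hv => hH.degree_eq_two (mem_triangleVertices.1 hv)
  have h3 : ∑ v ∈ leaves H, H.degree v = (leaves H).card * 1 :=
    Finset.sum_const_nat fun v hv => mem_leaves.1 hv
  rw [h2, h3]
  ring

end PathFourFree

/-! ### The link of a vertex -/

/-- The graph induced by `G` on the neighbourhood of `u`, kept on the vertex set `V`: all vertices
outside `N(u)` are isolated. -/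
def linkGraph {V : Type*} (G : SimpleGraph V) (u : V) : SimpleGraph V where
  Adj x y := G.Adj u x ∧ G.Adj u y ∧ G.Adj x y
  symm := ⟨fun _ _ h => ⟨h.2.1, h.1, h.2.2.symm⟩⟩
  loopless := ⟨fun _ h => G.irrefl h.2.2⟩

instance linkGraphDecidable {V : Type*} (G : SimpleGraph V) [DecidableRel G.Adj] (u : V) :
    DecidableRel (linkGraph G u).Adj :=
  fun x y => inferInstanceAs (Decidable (G.Adj u x ∧ G.Adj u y ∧ G.Adj x y))

theorem linkGraph_adj {V : Type*} {G : SimpleGraph V} {u x y : V} :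
    (linkGraph G u).Adj x y ↔ G.Adj u x ∧ G.Adj u y ∧ G.Adj x y :=
  Iff.rfl

theorem pathFourFree_linkGraph {V : Type*} {G : SimpleGraph V} (hG : (thetaGraph 1 2 3).Free G)
    (u : V) : PathFourFree (linkGraph G u) := by
  rintro a b c d ⟨ha, hb, hab⟩ ⟨-, hc, hbc⟩ ⟨-, hd, hcd⟩ hac hbd
  by_contra had
  exact had (eq_of_thetaGraph_free hG hb hd ha hc.ne' hbc.symm hcd hbd hab.symm hac)

theorem adj_of_degree_linkGraph_ne_zero {V : Type*} [Fintype V] {G : SimpleGraph V}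
    [DecidableRel G.Adj] {u v : V} (hv : (linkGraph G u).degree v ≠ 0) :
    G.Adj u v := by
  obtain ⟨x, hx⟩ := ((linkGraph G u).degree_pos_iff_exists_adj v).1 (Nat.pos_of_ne_zero hv)
  exact hx.1

section Link

variable {V : Type*} [Fintype V] [DecidableEq V] (G : SimpleGraph V) [DecidableRel G.Adj]

/-- The number of common neighbours of `u` and `w`. -/
def codegree (u w : V) : ℕ := (G.neighborFinset w ∩ G.neighborFinset u).card

variable {G}

theorem degree_linkGraph {u v : V} (hv : G.Adj u v) :
    (linkGraph G u).degree v = codegree G u v := by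
  rw [← SimpleGraph.card_neighborFinset_eq_degree, codegree]
  congr 1
  ext x
  simp only [SimpleGraph.mem_neighborFinset, linkGraph_adj, Finset.mem_inter]
  tauto

theorem sum_degree_neighborFinset (u : V) :
    ∑ v ∈ G.neighborFinset u, G.degree v = ∑ w, codegree G u w := by
  have := Finset.sum_card_bipartiteAbove_eq_sum_card_bipartiteBelow (s := G.neighborFinset u)
    (t := Finset.univ) (fun v w => G.Adj v w)
  convert this using 2 with v hv w hw
  · rw [← SimpleGraph.card_neighborFinset_eq_degree]
    congr 1
    ext x
    simp [Finset.bipartiteAbove]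
  · rw [codegree]
    congr 1
    ext x
    simp [Finset.bipartiteBelow, SimpleGraph.adj_comm, and_comm]

variable (G) in
/-- The neighbours of `u` that are isolated in its link. -/
def linkIsolated (u : V) : Finset V :=
  (G.neighborFinset u).filter fun v => codegree G u v = 0

theorem mem_linkIsolated {u v : V} : v ∈ linkIsolated G u ↔ G.Adj u v ∧ codegree G u v = 0 := by
  simp [linkIsolated]

theorem card_add_card_linkIsolated (hG : (thetaGraph 1 2 3).Free G) (u : V) :
    (starCentres (linkGraph G u)).card + (triangleVertices (linkGraph G u)).card +
      (leaves (linkGraph G u)).card + (linkIsolated G u).card = G.degree u := by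
  rw [← (pathFourFree_linkGraph hG u).card_union, ← Finset.card_union_of_disjoint,
    ← SimpleGraph.card_neighborFinset_eq_degree]
  · congr 1
    ext v
    rw [Finset.mem_union, mem_linkIsolated, SimpleGraph.mem_neighborFinset]
    constructor
    · rintro (h | h)
      · refine adj_of_degree_linkGraph_ne_zero fun h0 => ?_
        simp only [Finset.mem_union, mem_starCentres, mem_triangleVertices, mem_leaves, h0] at h
        rcases h with (h | h) | h
        · omega
        · have := (pathFourFree_linkGraph hG u).degree_eq_two h
          omega
        · omega
      · exact h.1
    · intro h
      rcases Nat.eq_zero_or_pos (codegree G u v) with h0 | h0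
      · exact Or.inr ⟨h, h0⟩
      · exact Or.inl (mem_of_degree_pos (by rwa [degree_linkGraph h]))
  · refine Finset.disjoint_left.2 fun v hv hv' => ?_
    obtain ⟨h, h0⟩ := mem_linkIsolated.1 hv'
    rw [← degree_linkGraph h] at h0
    simp only [Finset.mem_union, mem_starCentres, mem_triangleVertices, mem_leaves, h0] at hv
    rcases hv with (hv | hv) | hv
    · omega
    · have := (pathFourFree_linkGraph hG u).degree_eq_two hv
      omega
    · omega

theorem sum_codegree_neighborFinset (u : V) :
    ∑ v ∈ G.neighborFinset u, codegree G u v = ∑ v, (linkGraph G u).degree v := by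
  rw [← Finset.sum_subset (Finset.subset_univ (G.neighborFinset u))]
  · refine Finset.sum_congr rfl fun v hv => ?_
    rw [degree_linkGraph ((G.mem_neighborFinset _ _).1 hv)]
  · intro v _ hv
    by_contra h
    exact hv ((G.mem_neighborFinset _ _).2 (adj_of_degree_linkGraph_ne_zero h))

/-- A vertex outside the closed neighbourhood of `u` with several neighbours in `N(u)` is joined
either to isolated vertices of the link only, or to both ends of one component `K₂` of the link. -/
theorem codegree_cases (hG : (thetaGraph 1 2 3).Free G) {u w : V} (hwu : w ≠ u)
    (hw : ¬ G.Adj u w) :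
    codegree G u w ≤ 1 ∨ codegree G u w ≤ (linkIsolated G u).card ∨
      codegree G u w ≤ 2 ∧ ∃ x a, (linkGraph G u).Adj x a ∧ (linkGraph G u).degree x = 1 ∧
        (linkGraph G u).degree a = 1 := by
  by_cases hsub : G.neighborFinset w ∩ G.neighborFinset u ⊆ linkIsolated G u
  · exact Or.inr (Or.inl (Finset.card_le_card hsub))
  obtain ⟨x, hx, hx0⟩ := Finset.not_subset.1 hsub
  simp only [Finset.mem_inter, SimpleGraph.mem_neighborFinset] at hx
  obtain ⟨hwx, hux⟩ := hx
  have : codegree G u x ≠ 0 := fun h => hx0 (mem_linkIsolated.2 ⟨hux, h⟩)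
  obtain ⟨a, ha⟩ := Finset.card_ne_zero.1 this
  simp only [Finset.mem_inter, SimpleGraph.mem_neighborFinset] at ha
  obtain ⟨hxa, hua⟩ := ha
  have haw : a ≠ w := fun h => hw (h ▸ hua)
  have hs : G.neighborFinset w ∩ G.neighborFinset u ⊆ {x, a} := by
    intro y hy
    simp only [Finset.mem_inter, SimpleGraph.mem_neighborFinset] at hy
    rw [Finset.mem_insert, Finset.mem_singleton, or_iff_not_imp_left]
    exact fun hyx => (eq_of_thetaGraph_free hG hux hy.2 hua hwu hwx hy.1 (Ne.symm hyx) hxa haw).symm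
  have h2 : codegree G u w ≤ 2 := (Finset.card_le_card hs).trans Finset.card_le_two
  by_cases hwa : G.Adj w a
  · refine Or.inr (Or.inr ⟨h2, x, a, ⟨hux, hua, hxa⟩, ?_, ?_⟩)
    · refine degree_eq_one_of_forall ⟨hux, hua, hxa⟩ fun b hb => ?_
      exact eq_of_thetaGraph_free hG hux hua hb.2.1 hwu hwx hwa hxa.ne hb.2.2
        fun h => hw (h ▸ hb.2.1)
    · refine degree_eq_one_of_forall ⟨hua, hux, hxa.symm⟩ fun b hb => ?_
      exact eq_of_thetaGraph_free hG hua hux hb.2.1 hwu hwa hwx hxa.ne' hb.2.2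
        fun h => hw (h ▸ hb.2.1)
  · left
    have : G.neighborFinset w ∩ G.neighborFinset u ⊆ {x} := by
      intro y hy
      have h1 := hs hy
      simp only [Finset.mem_inter, SimpleGraph.mem_neighborFinset] at hy
      simp only [Finset.mem_insert, Finset.mem_singleton] at h1 ⊢
      rcases h1 with h1 | rfl
      · exact h1
      · exact absurd hy.1 hwa
    exact (Finset.card_le_card this).trans (Finset.card_singleton x).le

theorem sum_degree_neighborFinset_eq (u : V) :
    ∑ v ∈ G.neighborFinset u, G.degree v = G.degree u + ∑ v, (linkGraph G u).degree v +
      ∑ w ∈ Finset.univ.filter (fun w => w ≠ u ∧ ¬ G.Adj u w), codegree G u w := by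
  rw [sum_degree_neighborFinset, ← sum_codegree_neighborFinset,
    ← Finset.sum_filter_add_sum_filter_not Finset.univ (fun w => w ≠ u ∧ ¬ G.Adj u w),
    add_comm]
  congr 1
  have : Finset.univ.filter (fun w => ¬ (w ≠ u ∧ ¬ G.Adj u w)) =
      insert u (G.neighborFinset u) := by
    ext w
    simp only [Finset.mem_filter, Finset.mem_univ, true_and, Finset.mem_insert,
      SimpleGraph.mem_neighborFinset]
    tauto
  rw [this, Finset.sum_insert (by simp)]
  simp [codegree]

theorem card_filter_not_adj (u : V) :
    (Finset.univ.filter (fun w => w ≠ u ∧ ¬ G.Adj u w)).card + (G.degree u + 1) =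
      Fintype.card V := by
  have h1 : (insert u (G.neighborFinset u)).card = G.degree u + 1 := by
    rw [Finset.card_insert_of_notMem (by simp), SimpleGraph.card_neighborFinset_eq_degree]
  rw [← h1, ← Finset.card_union_of_disjoint, ← Finset.card_univ]
  · congr 1
    ext w
    simp only [Finset.mem_union, Finset.mem_filter, Finset.mem_univ, true_and, Finset.mem_insert,
      SimpleGraph.mem_neighborFinset, iff_true]
    tauto
  · refine Finset.disjoint_left.2 fun w hw => ?_
    simp only [Finset.mem_filter, Finset.mem_univ, true_and] at hw
    simpa using hw

/-- In the three cases, the link has at least two isolated vertices; or it has a component `K₂`; or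
every vertex outside the closed neighbourhood of `u` has at most one neighbour in `N(u)`. -/
theorem sum_degree_neighborFinset_le (hG : (thetaGraph 1 2 3).Free G) (u : V) {m : ℕ}
    (hm : m + (G.degree u + 1) = Fintype.card V) :
    (∃ i, 2 ≤ i ∧ i ≤ G.degree u ∧
      ∑ v ∈ G.neighborFinset u, G.degree v + 2 * i ≤ 3 * G.degree u + i * m) ∨
    (2 ≤ G.degree u ∧
      ∑ v ∈ G.neighborFinset u, G.degree v + 2 ≤ 3 * G.degree u + 2 * m) ∨
    ∑ v ∈ G.neighborFinset u, G.degree v ≤ 3 * G.degree u + m := by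
  have hH := pathFourFree_linkGraph hG u
  have hE := sum_degree_neighborFinset_eq (G := G) u
  have hS := hH.sum_degree
  have hC := hH.sum_degree_starCentres_le_card_leaves
  have hN := card_add_card_linkIsolated hG u
  have hcard : (Finset.univ.filter (fun w => w ≠ u ∧ ¬ G.Adj u w)).card = m := by
    have := card_filter_not_adj (G := G) u
    omega
  have hW : ∀ k, (∀ w, w ≠ u → ¬ G.Adj u w → codegree G u w ≤ k) →
      ∑ w ∈ Finset.univ.filter (fun w => w ≠ u ∧ ¬ G.Adj u w), codegree G u w ≤ m * k := by
    intro k hk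
    rw [← hcard]
    refine Finset.sum_le_card_nsmul _ _ _ fun w hw => ?_
    simp only [Finset.mem_filter, Finset.mem_univ, true_and] at hw
    exact hk w hw.1 hw.2
  rcases Nat.lt_or_ge (linkIsolated G u).card 2 with hi | hi
  · by_cases hK : ∃ x a, (linkGraph G u).Adj x a ∧ (linkGraph G u).degree x = 1 ∧
        (linkGraph G u).degree a = 1
    · obtain ⟨x, a, hxa, hx, ha⟩ := hK
      have h2 := hH.sum_degree_starCentres_add_two_le hxa hx ha
      have h3 := hW 2 fun w h1 h2 => by
        rcases codegree_cases hG h1 h2 with h | h | h <;> omega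
      right
      left
      constructor <;> omega
    · have h3 := hW 1 fun w h1 h2 => by
        rcases codegree_cases hG h1 h2 with h | h | h
        · omega
        · omega
        · exact absurd h.2 hK
      right
      right
      omega
  · left
    have h3 := hW (linkIsolated G u).card fun w h1 h2 => by
      rcases codegree_cases hG h1 h2 with h | h | h <;> omega
    rw [mul_comm] at h3
    refine ⟨_, hi, by omega, ?_⟩
    omega

end Link

/-! ### Graphs without a universal vertex -/

/-- The row of a non-universal vertex `u` for the degree vector. A vertex of degree `1` is treated
separately because the bound `3 d(u)` for the edges at `u` and in its link is too weak there. -/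
theorem degree_mul_add_sum_lt {V : Type*} [Fintype V] [DecidableEq V] {n : ℕ} (hn : 6 ≤ n)
    (hV : Fintype.card V = n) {G : SimpleGraph V} [DecidableRel G.Adj]
    (hG : (thetaGraph 1 2 3).Free G) {u : V} (h0 : 1 ≤ G.degree u) (hu : G.degree u + 2 ≤ n)
    {r : ℝ} (hr : (n : ℝ) + 7 / 5 < r) :
    (G.degree u : ℝ) * G.degree u + ((∑ v ∈ G.neighborFinset u, G.degree v : ℕ) : ℝ) <
      r * G.degree u := by
  have hn' : (6 : ℝ) ≤ n := by exact_mod_cast hn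
  rcases Nat.lt_or_ge (G.degree u) 2 with h1 | h2
  · have hd : G.degree u = 1 := by omega
    have hE : ∑ v ∈ G.neighborFinset u, G.degree v ≤ n := by
      have := Finset.sum_le_card_nsmul (G.neighborFinset u) (fun v => G.degree v) n
        fun v _ => hV ▸ (G.degree_lt_card_verts v).le
      rwa [SimpleGraph.card_neighborFinset_eq_degree, hd, one_smul] at this
    have hE' : ((∑ v ∈ G.neighborFinset u, G.degree v : ℕ) : ℝ) ≤ n := by exact_mod_cast hE
    rw [hd]
    push_cast at hE' ⊢
    linarith
  obtain ⟨m, hm⟩ : ∃ m, m + (G.degree u + 1) = Fintype.card V := ⟨n - (G.degree u + 1), by omega⟩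
  have hcases := sum_degree_neighborFinset_le hG u hm
  rw [hV] at hm
  set E := ∑ v ∈ G.neighborFinset u, G.degree v
  set d := G.degree u
  have hm1 : 1 ≤ m := by omega
  have hd2 : (2 : ℝ) ≤ d := by exact_mod_cast h2
  have hm1' : (1 : ℝ) ≤ m := by exact_mod_cast hm1
  have hmR : (m : ℝ) + (d + 1) = n := by exact_mod_cast hm
  have hrd : ((n : ℝ) + 7 / 5) * d < r * d := mul_lt_mul_of_pos_right hr (by linarith)
  rcases hcases with ⟨i, hi, hid, hE⟩ | ⟨-, hE⟩ | hE
  · have hE' : (E : ℝ) + 2 * i ≤ 3 * d + i * m := by exact_mod_cast hE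
    have hid' : (i : ℝ) ≤ d := by exact_mod_cast hid
    have hi' : (2 : ℝ) ≤ i := by exact_mod_cast hi
    nlinarith [mul_nonneg (sub_nonneg.2 hid') (sub_nonneg.2 hm1')]
  · have hE' : (E : ℝ) + 2 ≤ 3 * d + 2 * m := by exact_mod_cast hE
    nlinarith [mul_nonneg (sub_nonneg.2 hd2) (sub_nonneg.2 hm1')]
  · have hE' : (E : ℝ) ≤ 3 * d + m := by exact_mod_cast hE
    nlinarith [mul_nonneg (sub_nonneg.2 hd2) (sub_nonneg.2 hm1')]

/-- The degree vector (with isolated vertices given weight `1` to keep it positive) is a test vector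
for the Collatz–Wielandt bound. -/
theorem signlessRadius_lt_of_no_universal {V : Type*} [Fintype V] [DecidableEq V] {n : ℕ}
    (hn : 6 ≤ n) (hV : Fintype.card V = n) {G : SimpleGraph V} [DecidableRel G.Adj]
    (hG : (thetaGraph 1 2 3).Free G) (hdeg : ∀ u, G.degree u + 2 ≤ n)
    {r : ℝ} (hr : (n : ℝ) + 7 / 5 < r) : signlessRadius G < r := by
  have : Nonempty V := Fintype.card_pos_iff.1 (by omega)
  have hr0 : 0 < r := lt_trans (by positivity) hr
  refine signlessRadius_lt_of_pos G (fun v => ((max (G.degree v) 1 : ℕ) : ℝ))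
    (fun v => by positivity) fun u => ?_
  have hsum : ∑ w ∈ G.neighborFinset u, ((max (G.degree w) 1 : ℕ) : ℝ) =
      ((∑ v ∈ G.neighborFinset u, G.degree v : ℕ) : ℝ) := by
    rw [Nat.cast_sum]
    refine Finset.sum_congr rfl fun w hw => ?_
    rw [max_eq_left]
    exact (G.degree_pos_iff_exists_adj w).2 ⟨u, ((G.mem_neighborFinset _ _).1 hw).symm⟩
  simp only [hsum]
  rcases Nat.eq_zero_or_pos (G.degree u) with h0 | h0
  · have hN : G.neighborFinset u = ∅ := by
      rwa [← Finset.card_eq_zero, SimpleGraph.card_neighborFinset_eq_degree]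
    simp [h0, hN, hr0]
  · rw [max_eq_left h0]
    exact degree_mul_add_sum_lt hn hV hG h0 (hdeg u) hr

/-! ### Graphs with a universal vertex -/

open Classical in
/-- Weights on the components of a graph whose components are triangles and stars: a star centre of
degree `k ≥ 2` gets `k - 1`, a vertex of a triangle `1 / 3`, every other vertex `0`. -/
noncomputable def starWeight {V : Type*} [Fintype V] (H : SimpleGraph V) [DecidableRel H.Adj]
    (v : V) : ℝ :=
  if v ∈ starCentres H then (H.degree v : ℝ) - 1 else if v ∈ triangleVertices H then 1 / 3 else 0

section StarWeight

variable {V : Type*} [Fintype V] {H : SimpleGraph V} [DecidableRel H.Adj]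

theorem starWeight_of_mem_starCentres {v : V} (hv : v ∈ starCentres H) :
    starWeight H v = (H.degree v : ℝ) - 1 := if_pos hv

theorem starWeight_of_inTriangle {v : V} (hv : InTriangle H v) : starWeight H v = 1 / 3 := by
  rw [starWeight, if_neg fun h => (mem_starCentres.1 h).2 hv, if_pos (mem_triangleVertices.2 hv)]

theorem starWeight_nonneg (v : V) : 0 ≤ starWeight H v := by
  unfold starWeight
  split_ifs with h
  · have : (2 : ℝ) ≤ H.degree v := by exact_mod_cast (mem_starCentres.1 h).1
    linarith
  · norm_num
  · rfl

theorem starWeight_le {n : ℕ} (hn : 6 ≤ n) (hdeg : ∀ v, H.degree v + 3 ≤ n) (v : V) :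
    starWeight H v ≤ n - 4 := by
  have hn' : (6 : ℝ) ≤ n := by exact_mod_cast hn
  have : (H.degree v : ℝ) + 3 ≤ n := by exact_mod_cast hdeg v
  unfold starWeight
  split_ifs <;> linarith

variable [DecidableEq V]

theorem PathFourFree.starWeight_of_degree_le_one (hH : PathFourFree H) {v : V}
    (hv : H.degree v ≤ 1) : starWeight H v = 0 := by
  rw [starWeight, if_neg, if_neg]
  · intro h
    have := hH.degree_eq_two (mem_triangleVertices.1 h)
    omega
  · intro h
    have := (mem_starCentres.1 h).1
    omega

theorem sum_starWeight : ∑ v, starWeight H v =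
    ∑ c ∈ starCentres H, (H.degree c : ℝ) - (starCentres H).card +
      (triangleVertices H).card * (1 / 3) := by
  have h1 : ∑ v, starWeight H v = ∑ v ∈ starCentres H ∪ triangleVertices H, starWeight H v := by
    symm
    refine Finset.sum_subset (Finset.subset_univ _) fun v _ hv => ?_
    rw [Finset.mem_union, not_or] at hv
    rw [starWeight, if_neg hv.1, if_neg hv.2]
  rw [h1, Finset.sum_union disjoint_starCentres_triangleVertices,
    Finset.sum_congr rfl fun v hv => starWeight_of_mem_starCentres hv,
    Finset.sum_congr rfl fun v hv => starWeight_of_inTriangle (mem_triangleVertices.1 hv)]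
  simp

/-- The total weight is below `n - 3`, its value for a single star on `n - 1` vertices. -/
theorem PathFourFree.sum_starWeight_lt (hH : PathFourFree H) {n : ℕ} (hn : 6 ≤ n)
    (hdeg : ∀ v, H.degree v + 3 ≤ n)
    (hcard : (starCentres H).card + (triangleVertices H).card + (leaves H).card + 1 ≤ n) :
    ∑ v, starWeight H v < n - 3 := by
  have hn' : (6 : ℝ) ≤ n := by exact_mod_cast hn
  have hC : (∑ c ∈ starCentres H, (H.degree c : ℝ)) ≤ (leaves H).card := by
    exact_mod_cast hH.sum_degree_starCentres_le_card_leaves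
  have hcard' :
      ((starCentres H).card : ℝ) + (triangleVertices H).card + (leaves H).card + 1 ≤ n := by
    exact_mod_cast hcard
  have hT : (0 : ℝ) ≤ (triangleVertices H).card := Nat.cast_nonneg _
  rw [sum_starWeight]
  rcases Nat.lt_trichotomy (starCentres H).card 1 with h | h | h
  · have h0 : starCentres H = ∅ := Finset.card_eq_zero.1 (by omega)
    have hL : (0 : ℝ) ≤ (leaves H).card := Nat.cast_nonneg _
    simp only [h0, Finset.sum_empty, Finset.card_empty, Nat.cast_zero] at hcard' ⊢
    linarith
  · obtain ⟨c, hc⟩ := Finset.card_eq_one.1 h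
    have hd : (H.degree c : ℝ) + 3 ≤ n := by exact_mod_cast hdeg c
    simp only [hc, Finset.sum_singleton, Finset.card_singleton, Nat.cast_one] at hcard' hC ⊢
    rcases Nat.eq_zero_or_pos (triangleVertices H).card with h0 | h0
    · rw [h0]
      push_cast
      linarith
    · have : (1 : ℝ) ≤ (triangleVertices H).card := by exact_mod_cast h0
      linarith
  · have : (2 : ℝ) ≤ (starCentres H).card := by exact_mod_cast h
    linarith

end StarWeight

section Universal

variable {V : Type*} [Fintype V] [DecidableEq V] {G : SimpleGraph V} [DecidableRel G.Adj] {u : V}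

theorem neighborFinset_eq_insert (hu : ∀ v, v ≠ u → G.Adj u v) {v : V} (hv : v ≠ u) :
    G.neighborFinset v = insert u ((linkGraph G u).neighborFinset v) := by
  ext w
  rw [SimpleGraph.mem_neighborFinset, Finset.mem_insert, SimpleGraph.mem_neighborFinset,
    linkGraph_adj]
  rcases eq_or_ne w u with rfl | hw
  · simp [(hu v hv).symm]
  · simp [hw, hu v hv, hu w hw]

theorem neighborFinset_eq_erase (hu : ∀ v, v ≠ u → G.Adj u v) :
    G.neighborFinset u = Finset.univ.erase u := by
  ext w
  rw [SimpleGraph.mem_neighborFinset, Finset.mem_erase]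
  exact ⟨fun h => ⟨h.ne', Finset.mem_univ _⟩, fun h => hu w h.1⟩

theorem degree_eq_degree_linkGraph_add_one (hu : ∀ v, v ≠ u → G.Adj u v) {v : V} (hv : v ≠ u) :
    G.degree v = (linkGraph G u).degree v + 1 := by
  rw [← SimpleGraph.card_neighborFinset_eq_degree, neighborFinset_eq_insert hu hv,
    Finset.card_insert_of_notMem, SimpleGraph.card_neighborFinset_eq_degree]
  intro h
  exact G.irrefl ((SimpleGraph.mem_neighborFinset _ _ _).1 h).2.1

/-- The test vector is a perturbation of the eigenvector `(r - 2, 2)` of `S_{n,2}`: the universal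
vertex gets `r - 2` and every other vertex `v` gets `2 + A g(v)`, where `g` is `starWeight` and
`A = r / (r - 1) = (r - 4) / (n - 3)`, so that the centre of a star with `n - 2` leaves would also
get `r - 2`. The slack in the row of the centre of a star with `k` leaves is `A k (n - 2 - k)`. -/
theorem signlessRadius_lt_of_universal {n : ℕ} (hn : 6 ≤ n) (hV : Fintype.card V = n)
    (hG : (thetaGraph 1 2 3).Free G) (hu : ∀ v, v ≠ u → G.Adj u v)
    (hdeg : ∀ v, (linkGraph G u).degree v + 3 ≤ n)
    {r : ℝ} (hr : r * r = (n + 2) * r - 4) (hr' : (n : ℝ) + 7 / 5 < r) :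
    signlessRadius G < r := by
  have : Nonempty V := ⟨u⟩
  have hn' : (6 : ℝ) ≤ n := by exact_mod_cast hn
  have hH : PathFourFree (linkGraph G u) := pathFourFree_linkGraph hG u
  obtain ⟨A, hA⟩ : ∃ A, A = r / (r - 1) := ⟨_, rfl⟩
  have hr1 : 0 < r - 1 := by linarith
  have hA1 : A * (r - 1) = r := by rw [hA, div_mul_cancel₀ _ hr1.ne']
  have hA2 : A * (n - 3) = r - 4 := by
    have : (A * (n - 3) - (r - 4)) * (r - 1) = 0 := by
      linear_combination (n - 3 : ℝ) * hA1 - hr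
    rcases mul_eq_zero.1 this with h | h <;> linarith
  have hA3 : 1 < A := by
    rw [hA, one_lt_div hr1]
    linarith
  have hdegu : G.degree u + 1 = n := by
    rw [← SimpleGraph.card_neighborFinset_eq_degree, neighborFinset_eq_erase hu,
      Finset.card_erase_of_mem (Finset.mem_univ _), Finset.card_univ, hV]
    omega
  have hcard := card_add_card_linkIsolated hG u
  have hsum := hH.sum_starWeight_lt hn hdeg (by omega)
  have hgu : starWeight (linkGraph G u) u = 0 := by
    refine hH.starWeight_of_degree_le_one ?_
    by_contra h
    exact G.irrefl (adj_of_degree_linkGraph_ne_zero (G := G) (u := u) (v := u) (by omega))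
  set y : V → ℝ := fun v => if v = u then r - 2 else 2 + A * starWeight (linkGraph G u) v with hy
  have hyu : y u = r - 2 := if_pos rfl
  have hyv : ∀ v, v ≠ u → y v = 2 + A * starWeight (linkGraph G u) v := fun v hv => if_neg hv
  have hg0 : ∀ v, 0 ≤ A * starWeight (linkGraph G u) v := fun v =>
    mul_nonneg (by linarith) (starWeight_nonneg v)
  refine signlessRadius_lt_of_pos G y (fun v => ?_) fun v => ?_
  · rcases eq_or_ne v u with hv | hv
    · rw [hv, hyu]
      linarith
    · rw [hyv v hv]
      linarith [hg0 v]
  rcases eq_or_ne v u with hv | hv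
  · -- the row of the universal vertex
    rw [hv]
    have h1 : ∑ w ∈ G.neighborFinset u, y w =
        ∑ w ∈ G.neighborFinset u, (2 + A * starWeight (linkGraph G u) w) :=
      Finset.sum_congr rfl fun w hw => hyv w ((G.mem_neighborFinset _ _).1 hw).ne'
    have h2 : ((G.degree u : ℕ) : ℝ) = n - 1 := by
      rw [← hdegu]
      push_cast
      ring
    have h3 : ∑ w ∈ G.neighborFinset u, starWeight (linkGraph G u) w =
        ∑ w, starWeight (linkGraph G u) w := by
      rw [neighborFinset_eq_erase hu, Finset.sum_erase _ hgu]
    rw [h1, Finset.sum_add_distrib, ← Finset.mul_sum, h3, Finset.sum_const,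
      SimpleGraph.card_neighborFinset_eq_degree, nsmul_eq_mul, h2, hyu]
    have h4 : A * ∑ w, starWeight (linkGraph G u) w < A * (n - 3) :=
      mul_lt_mul_of_pos_left hsum (by linarith)
    rw [hA2] at h4
    nlinarith
  · -- the row of another vertex
    have hsplit : ∑ w ∈ G.neighborFinset v, y w =
        r - 2 + ∑ w ∈ (linkGraph G u).neighborFinset v, (2 + A * starWeight (linkGraph G u) w) := by
      rw [neighborFinset_eq_insert hu hv, Finset.sum_insert, hyu]
      · congr 1
        refine Finset.sum_congr rfl fun w hw => hyv w ?_
        exact ((SimpleGraph.mem_neighborFinset _ _ _).1 hw).2.1.ne'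
      · intro h
        exact G.irrefl ((SimpleGraph.mem_neighborFinset _ _ _).1 h).2.1
    have hconst : ∀ a : ℝ, (∀ w, (linkGraph G u).Adj v w → starWeight (linkGraph G u) w ≤ a) →
        ∑ w ∈ (linkGraph G u).neighborFinset v, (2 + A * starWeight (linkGraph G u) w) ≤
          (linkGraph G u).degree v * (2 + A * a) := by
      intro a ha
      rw [← SimpleGraph.card_neighborFinset_eq_degree, ← nsmul_eq_mul]
      refine Finset.sum_le_card_nsmul _ _ _ fun w hw => ?_
      have := mul_le_mul_of_nonneg_left (ha w ((SimpleGraph.mem_neighborFinset _ _ _).1 hw))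
        (show 0 ≤ A by linarith)
      linarith
    rw [hsplit, hyv v hv, degree_eq_degree_linkGraph_add_one hu hv]
    push_cast
    by_cases hT : InTriangle (linkGraph G u) v
    · have h1 := hconst (1 / 3) fun w hw => by
        refine (starWeight_of_inTriangle ?_).le
        obtain ⟨a, b, ha, hb, hab⟩ := hT
        by_cases hwa : w = a
        · subst hwa
          exact ⟨v, b, ha.symm, hab, hb⟩
        · by_cases hwb : w = b
          · subst hwb
            exact ⟨v, a, hb.symm, hab.symm, ha⟩
          · exact absurd (hH hw.symm ha hab hwa hb.ne) hwb
      rw [hH.degree_eq_two hT] at h1 ⊢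
      rw [starWeight_of_inTriangle hT]
      push_cast at h1 ⊢
      nlinarith
    · rcases Nat.lt_or_ge ((linkGraph G u).degree v) 2 with h2 | h2
      · rw [hH.starWeight_of_degree_le_one (by omega)]
        have h1 := hconst (n - 4) fun w _ => starWeight_le hn hdeg w
        have h3 : 2 + A * ((n : ℝ) - 4) < r - 2 := by linarith
        have h4 : (0 : ℝ) ≤ 2 + A * ((n : ℝ) - 4) :=
          add_nonneg (by norm_num) (mul_nonneg (by linarith) (by linarith))
        rcases Nat.le_one_iff_eq_zero_or_eq_one.1 (Nat.lt_succ_iff.1 h2) with h0 | h0 <;>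
          rw [h0] at h1 ⊢ <;> push_cast at h1 ⊢ <;> linarith
      · have hvC : v ∈ starCentres (linkGraph G u) := mem_starCentres.2 ⟨h2, hT⟩
        have h1 := hconst 0 fun w hw =>
          (hH.starWeight_of_degree_le_one (hH.degree_eq_one hvC hw).le).le
        rw [starWeight_of_mem_starCentres hvC]
        have hk : ((linkGraph G u).degree v : ℝ) + 3 ≤ n := by exact_mod_cast hdeg v
        have hk2 : (2 : ℝ) ≤ (linkGraph G u).degree v := by exact_mod_cast h2
        set k : ℝ := ((linkGraph G u).degree v : ℝ)
        have hdef : 0 < A * (k * (n - 2 - k)) :=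
          mul_pos (by linarith) (mul_pos (by linarith) (by linarith))
        have hid : r * (2 + A * (k - 1)) - ((k + 1) * (2 + A * (k - 1)) + (r - 2 + k * 2)) =
            A * (k * (n - 2 - k)) := by
          linear_combination (k - 1) * hA1 - k * hA2
        linarith

theorem nonempty_iso_splitGraph_of_universal {n : ℕ} (hn : 6 ≤ n) (hV : Fintype.card V = n)
    (hG : (thetaGraph 1 2 3).Free G) (hu : ∀ v, v ≠ u → G.Adj u v) {c : V}
    (hc : n ≤ (linkGraph G u).degree c + 2) : Nonempty (G ≃g splitGraph n 2) := by
  have huc : G.Adj u c := adj_of_degree_linkGraph_ne_zero (G := G) (u := u) (v := c) (by omega)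
  have hdc := degree_eq_degree_linkGraph_add_one hu huc.ne'
  have hc' : ∀ v, v ≠ c → G.Adj c v := by
    have h1 : G.neighborFinset c = Finset.univ.erase c := by
      refine Finset.eq_of_subset_of_card_le (fun w hw => ?_) ?_
      · exact Finset.mem_erase.2 ⟨((G.mem_neighborFinset _ _).1 hw).ne', Finset.mem_univ _⟩
      · rw [Finset.card_erase_of_mem (Finset.mem_univ _), Finset.card_univ, hV,
          SimpleGraph.card_neighborFinset_eq_degree]
        omega
    intro v hv
    rw [← SimpleGraph.mem_neighborFinset, h1]
    exact Finset.mem_erase.2 ⟨hv, Finset.mem_univ _⟩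
  refine nonempty_iso_splitGraph hV G huc.ne fun x y => ⟨fun h => ⟨h.ne, ?_⟩, ?_⟩
  · by_contra! hne
    obtain ⟨⟨hxu, hxc⟩, hyu, hyc⟩ := hne
    obtain ⟨z, hz⟩ : ∃ z, z ∉ ({u, c, x, y} : Finset V) := by
      by_contra! hall
      have h1 : (Finset.univ : Finset V).card ≤ ({u, c, x, y} : Finset V).card :=
        Finset.card_le_card fun z _ => hall z
      have h2 : ({u, c, x, y} : Finset V).card ≤ 4 := Finset.card_le_four
      rw [Finset.card_univ] at h1
      omega
    simp only [Finset.mem_insert, Finset.mem_singleton, not_or] at hz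
    obtain ⟨hzu, hzc, hzx, hzy⟩ := hz
    exact hzy (pathFourFree_linkGraph hG u
      (show (linkGraph G u).Adj z c from ⟨hu z hzu, huc, (hc' z hzc).symm⟩)
      (show (linkGraph G u).Adj c x from ⟨huc, hu x hxu, hc' x hxc⟩)
      (show (linkGraph G u).Adj x y from ⟨hu x hxu, hu y hyu, h⟩) hzx hyc.symm)
  · rintro ⟨hxy, (rfl | rfl) | (rfl | rfl)⟩
    · exact hu y hxy.symm
    · exact hc' y hxy.symm
    · exact (hu x hxy).symm
    · exact (hc' x hxy).symm

end Universal

/-! ### The extremal theorem -/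

theorem theorem1p3 {V : Type*} [Fintype V] [DecidableEq V] (n : ℕ) (hn : 6 ≤ n)
    (hV : Fintype.card V = n) (G : SimpleGraph V) [DecidableRel G.Adj]
    (hG : (thetaGraph 1 2 3).Free G) :
    signlessRadius G ≤ signlessRadius (splitGraph n 2) ∧
      (signlessRadius G = signlessRadius (splitGraph n 2) ↔ Nonempty (G ≃g splitGraph n 2)) := by
  obtain ⟨r, hr, hr'⟩ := exists_root_gt hn
  have hS := le_signlessRadius_splitGraph hn hr hr'
  have key : Nonempty (G ≃g splitGraph n 2) ∨ signlessRadius G < r := by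
    by_cases hdeg : ∀ u, G.degree u + 2 ≤ n
    · exact Or.inr (signlessRadius_lt_of_no_universal hn hV hG hdeg hr')
    push Not at hdeg
    obtain ⟨u, hu⟩ := hdeg
    have hu' : ∀ v, v ≠ u → G.Adj u v := by
      intro v hv
      by_contra h
      have h1 := card_filter_not_adj (G := G) u
      have h2 : 0 < (Finset.univ.filter (fun w => w ≠ u ∧ ¬ G.Adj u w)).card :=
        Finset.card_pos.2 ⟨v, by simp [hv, h]⟩
      omega
    by_cases hlink : ∀ v, (linkGraph G u).degree v + 3 ≤ n
    · exact Or.inr (signlessRadius_lt_of_universal hn hV hG hu' hlink hr hr')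
    push Not at hlink
    obtain ⟨c, hc⟩ := hlink
    exact Or.inl (nonempty_iso_splitGraph_of_universal hn hV hG hu' (c := c) (by omega))
  rcases key with ⟨⟨e⟩⟩ | h
  · have := signlessRadius_congr e
    exact ⟨this.le, fun _ => ⟨e⟩, fun _ => this⟩
  · have hlt := h.trans_le hS
    exact ⟨hlt.le, fun h' => absurd h' hlt.ne, fun ⟨e⟩ => signlessRadius_congr e⟩
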